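/- Work in the ring of symmetric functions over $\mathbb{Z}$ in infinitely many variables. For a partition $\lambda$ let $s_\lambda=\sum_T x^T$ be the Schur function, the sum being over all semistandard Young tableaux $T$ of shape $\lambda$. For integers $i,j\ge 0$ let $(2^i,1^j)$ denote the partition with $i$ parts equal to $2$ and $j$ parts equal to $1$, and write $(2^i)$ for $(2^i,1^0)$ and $(2^i,1)$ for $(2^i,1^1)$; for integers $i,j$ with $i<0$ or $j<0$ set $s_{(2^i,1^j)}=0$. For integers $a,b,r\ge0$ and $0\le k\le r$ put $$D(a,b,k,r)=s_{(2^{k-b-1},1^{b+2-a})}\,s_{(2^{r-k-1})}+s_{(2^{k-b},1^{b-a})}\,s_{(2^{r-k-1})}-s_{(2^{k-b-1},1^{b+1-a})}\,s_{(2^{r-k-1},1)}.$$ **Theorem.** For all integers $b\ge a\ge 0$ and $r\ge 0$, the symmetric function $\sum_{k=0}^r D(a,b,k,r)$ is Schur positive; that is, in its expansion $\sum_\lambda a_\lambda s_\lambda$ as a finite linear combination of Schur functions, all coefficients $a_\lambda$ are nonnegative. -/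

import Mathlib

namespace SemistandardYoungTableau

/-- The weight (type) of a semistandard tableau `T`: the finitely supported function counting, for
each `i`, the cells of the diagram that are filled with `i`. -/
noncomputable def weight {μ : YoungDiagram} (T : SemistandardYoungTableau μ) : ℕ →₀ ℕ :=
  ∑ c ∈ μ.cells, Finsupp.single (T c.1 c.2) 1

theorem weight_apply {μ : YoungDiagram} (T : SemistandardYoungTableau μ) (i : ℕ) :
    T.weight i = (μ.cells.filter fun c => T c.1 c.2 = i).card := by
  simp [weight, Finsupp.finsetSum_apply, Finsupp.single_apply]

/-- Only finitely many semistandard tableaux of a given shape have a given weight. -/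
theorem finite_weight_eq (μ : YoungDiagram) (d : ℕ →₀ ℕ) :
    Finite {T : SemistandardYoungTableau μ // T.weight = d} := by
  have hmem : ∀ T : {T : SemistandardYoungTableau μ // T.weight = d}, ∀ c : μ.cells,
      T.1 c.1.1 c.1.2 ∈ d.support := by
    intro T c
    rw [Finsupp.mem_support_iff, ← DFunLike.congr_fun T.2, weight_apply]
    exact Finset.card_ne_zero_of_mem (Finset.mem_filter.2 ⟨c.2, rfl⟩)
  refine Finite.of_injective
    (fun T (c : μ.cells) => (⟨T.1 c.1.1 c.1.2, hmem T c⟩ : d.support)) ?_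
  intro T T' h
  apply Subtype.ext
  ext i j
  by_cases hc : (i, j) ∈ μ
  · have := congrFun h ⟨(i, j), (YoungDiagram.mem_cells _).2 hc⟩
    exact congrArg Subtype.val this
  · rw [T.1.zeros hc, T'.1.zeros hc]

end SemistandardYoungTableau

/-- The Schur function `s_μ = ∑_T x^T` in infinitely many variables (indexed by `ℕ`), the sum over
all semistandard tableaux of shape `μ`, as a formal power series over `ℤ`: the coefficient of `x^d`
is the (finite) number of semistandard tableaux of shape `μ` and weight `d`. -/
noncomputable def schurFunction (μ : YoungDiagram) : MvPowerSeries ℕ ℤ :=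
  fun d => (Nat.card {T : SemistandardYoungTableau μ // T.weight = d} : ℤ)

/-- `f` is Schur positive (`s`-positive): it has an expansion `f = ∑ a_μ s_μ` as a finite linear
combination of Schur functions with all coefficients `a_μ` nonnegative. -/
def IsSchurPositive (f : MvPowerSeries ℕ ℤ) : Prop :=
  ∃ a : YoungDiagram →₀ ℤ, (∀ μ, 0 ≤ a μ) ∧ f = a.sum fun μ c => c • schurFunction μ

/-- The Young diagram of the partition `(2^i, 1^j)`: `i` rows of length `2`, then `j` rows of
length `1`. -/
def twoColumnDiagram (i j : ℕ) : YoungDiagram :=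
  YoungDiagram.ofRowLens (List.replicate i 2 ++ List.replicate j 1) <| by
    refine List.Pairwise.sortedGE (List.pairwise_append.2 ⟨?_, ?_, ?_⟩)
    · exact List.pairwise_replicate.2 (Or.inr le_rfl)
    · exact List.pairwise_replicate.2 (Or.inr le_rfl)
    · intro x hx y hy
      rw [List.eq_of_mem_replicate hx, List.eq_of_mem_replicate hy]
      norm_num

/-- The Schur function `s_{(2^i, 1^j)}` for integers `i`, `j`, which is `0` by convention if
`i < 0` or `j < 0`. -/
noncomputable def schurTwoColumn (i j : ℤ) : MvPowerSeries ℕ ℤ :=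
  if 0 ≤ i ∧ 0 ≤ j then schurFunction (twoColumnDiagram i.toNat j.toNat) else 0

/-- `D(a,b,k,r) = s_{(2^{k-b-1},1^{b+2-a})} s_{(2^{r-k-1})} + s_{(2^{k-b},1^{b-a})} s_{(2^{r-k-1})}
  - s_{(2^{k-b-1},1^{b+1-a})} s_{(2^{r-k-1},1)}`. -/
noncomputable def schurD (a b k r : ℤ) : MvPowerSeries ℕ ℤ :=
  schurTwoColumn (k - b - 1) (b + 2 - a) * schurTwoColumn (r - k - 1) 0
    + schurTwoColumn (k - b) (b - a) * schurTwoColumn (r - k - 1) 0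
    - schurTwoColumn (k - b - 1) (b + 1 - a) * schurTwoColumn (r - k - 1) 1

open Finset

/-! Put `u = r - 1 - a` and `v = r - 1 - b`. The sum is in fact the sum of the Schur functions whose
column lengths are `u - s ≥ v - t ≥ s ≥ t ≥ 0`, over all such pairs `(s, t)` (`sum_schurD_eq`);
positivity is then immediate.

By the dual Jacobi–Trudi identity (`truncVars_schurFunction`) each of these Schur functions is a 4 ×
4 determinant in elementary symmetric functions. The determinant changes sign under `s ↦ u + 2 - s`
and under `t ↦ v + 2 - t`, so the sum over admissible pairs equals the sum over the half plane `t ≤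
s` (`sum_interlacedPairs`). Expanding over permutations gives signed sums over translated half
planes, which cancel down to eight sums along diagonals (`sum_interlacedDet`). With `m = r - 1 - k`,
the products of 2 × 2 determinants in `schurD` expand to the same eight sums (`sum_pairDet_mul`).

Dual Jacobi–Trudi is proved by induction on the number of variables: deleting the largest entry
shortens a set of columns by one, and multilinearity in the rows gives the determinant the same
recursion. -/

/-- The determinant `det (e_{c_i - i + j})`. -/
def columnDet {R : Type*} [CommRing R] {N : ℕ} (e : ℤ → R) (c : Fin N → ℤ) : R :=
  (Matrix.of fun i j : Fin N => e (c i - (i : ℤ) + (j : ℤ))).det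

/-! ### Four-column determinants and cancellation by reflection. -/

section Algebra

variable {R : Type*} [CommRing R]

theorem columnDet_eq_zero_of_shifted_eq {N : ℕ} (e : ℤ → R) (c : Fin N → ℤ) {i j : Fin N}
    (hij : i ≠ j) (h : c i - (i : ℤ) = c j - (j : ℤ)) : columnDet e c = 0 :=
  Matrix.det_zero_of_row_eq hij (by ext k; simp [h])

theorem columnDet_eq_zero_of_row_neg {N : ℕ} {e : ℤ → R} (he : ∀ k < 0, e k = 0)
    (c : Fin N → ℤ) (i : Fin N) (h : c i - (i : ℤ) + N ≤ 0) : columnDet e c = 0 :=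
  Matrix.det_eq_zero_of_row_eq_zero i fun j => he _ (by have := j.2; omega)

theorem columnDet_swap {N : ℕ} (e : ℤ → R) (c c' : Fin N → ℤ) {i j : Fin N} (hij : i ≠ j)
    (hi : c' i - (i : ℤ) = c j - (j : ℤ)) (hj : c' j - (j : ℤ) = c i - (i : ℤ))
    (hk : ∀ k, k ≠ i → k ≠ j → c' k = c k) : columnDet e c' = - columnDet e c := by
  have h := Matrix.det_permute (Equiv.swap i j)
    (Matrix.of fun i j : Fin N => e (c i - (i : ℤ) + (j : ℤ)))
  rw [Equiv.Perm.sign_swap hij] at h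
  unfold columnDet
  have hM : (Matrix.of fun i j : Fin N => e (c' i - (i : ℤ) + (j : ℤ))) =
      (Matrix.of fun i j : Fin N => e (c i - (i : ℤ) + (j : ℤ))).submatrix (Equiv.swap i j) id := by
    ext k l
    by_cases h1 : k = i
    · subst h1; simp [hi]
    · by_cases h2 : k = j
      · subst h2; simp [hj]
      · simp [Equiv.swap_apply_of_ne_of_ne h1 h2, hk k h1 h2]
  rw [hM, h]
  simp

/-- The determinant of the four column lengths `u - s, v - t, s, t`. -/
def interlacedDet (e : ℤ → R) (u v : ℤ) (p : ℤ × ℤ) : R :=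
  columnDet e ![u - p.1, v - p.2, p.1, p.2]

theorem interlacedDet_reflect_fst (e : ℤ → R) (u v : ℤ) (p : ℤ × ℤ) :
    interlacedDet e u v (u + 2 - p.1, p.2) = - interlacedDet e u v p := by
  refine columnDet_swap e _ _ (i := 0) (j := 2) (by decide) ?_ ?_ ?_
  · simp; ring
  · simp; ring
  · intro k; fin_cases k <;> simp

theorem interlacedDet_reflect_snd (e : ℤ → R) (u v : ℤ) (p : ℤ × ℤ) :
    interlacedDet e u v (p.1, v + 2 - p.2) = - interlacedDet e u v p := by
  refine columnDet_swap e _ _ (i := 1) (j := 3) (by decide) ?_ ?_ ?_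
  · simp; ring
  · simp; ring
  · intro k; fin_cases k <;> simp

/-- A box outside which `interlacedDet` vanishes. -/
noncomputable def interlacedBox (u v : ℤ) : Finset (ℤ × ℤ) := Icc (-1) (u + 3) ×ˢ Icc 0 (v + 2)

/-- Beyond each side of the box one row has only negative indices. The box is stable under both
reflections. -/
theorem interlacedDet_eq_zero {e : ℤ → R} (he : ∀ k < 0, e k = 0) (u v : ℤ) (p : ℤ × ℤ)
    (hp : p ∉ interlacedBox u v) : interlacedDet e u v p = 0 := by
  simp only [interlacedBox, mem_product, mem_Icc] at hp
  by_cases h0 : u + 3 < p.1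
  · exact columnDet_eq_zero_of_row_neg he _ 0 (by simp; omega)
  by_cases h1 : v + 2 < p.2
  · exact columnDet_eq_zero_of_row_neg he _ 1 (by simp; omega)
  by_cases h2 : p.1 < -1
  · exact columnDet_eq_zero_of_row_neg he _ 2 (by simp; omega)
  · exact columnDet_eq_zero_of_row_neg he _ 3 (by simp; omega)

/-- The pairs `(s, t)` for which `u - s, v - t, s, t` are the column lengths of a Young diagram. -/
noncomputable def interlacedPairs (u v : ℤ) : Finset (ℤ × ℤ) :=
  (interlacedBox u v).filter fun p => p.2 ≤ p.1 ∧ p.1 + p.2 ≤ v ∧ p.1 ≤ u - v + p.2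

theorem sum_interlacedPairs (e : ℤ → R) {u v : ℤ} (huv : v ≤ u) :
    ∑ p ∈ interlacedPairs u v, interlacedDet e u v p =
      ∑ p ∈ (interlacedBox u v).filter (fun p => p.2 ≤ p.1), interlacedDet e u v p := by
  -- Reflecting `t` interchanges the conditions `t ≤ s` and `v + 2 ≤ s + t`; at a fixed point two
  -- rows coincide.
  have hA : ∑ p ∈ ((interlacedBox u v).filter (fun p => p.2 ≤ p.1)).filter
      (fun p => v + 2 ≤ p.1 + p.2), interlacedDet e u v p = 0 := by
    refine sum_involution (fun p _ => (p.1, v + 2 - p.2)) ?_ ?_ ?_ ?_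
    · intro p _
      rw [interlacedDet_reflect_snd, add_neg_cancel]
    · intro p _ hne heq
      apply hne
      have h2 := congrArg Prod.snd heq
      refine columnDet_eq_zero_of_shifted_eq e _ (i := 1) (j := 3) (by decide) ?_
      simp at h2 ⊢; omega
    · intro p hp
      simp only [interlacedBox, mem_filter, mem_product, mem_Icc] at hp ⊢
      omega
    · intro p _
      simp
  -- Reflecting `s` interchanges `s + t ≤ v + 1` and `u - v + t + 1 ≤ s`; the latter implies `t ≤ s`
  -- because `v ≤ u`.
  have hB : ∑ p ∈ (((interlacedBox u v).filter (fun p => p.2 ≤ p.1)).filter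
      (fun p => ¬ v + 2 ≤ p.1 + p.2)).filter (fun p => u - v + p.2 + 1 ≤ p.1),
        interlacedDet e u v p = 0 := by
    refine sum_involution (fun p _ => (u + 2 - p.1, p.2)) ?_ ?_ ?_ ?_
    · intro p _
      rw [interlacedDet_reflect_fst, add_neg_cancel]
    · intro p _ hne heq
      apply hne
      have h2 := congrArg Prod.fst heq
      refine columnDet_eq_zero_of_shifted_eq e _ (i := 0) (j := 2) (by decide) ?_
      simp at h2 ⊢; omega
    · intro p hp
      simp only [interlacedBox, mem_filter, mem_product, mem_Icc] at hp ⊢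
      omega
    · intro p _
      simp
  rw [← sum_filter_add_sum_filter_not ((interlacedBox u v).filter fun p => p.2 ≤ p.1)
      (fun p => v + 2 ≤ p.1 + p.2), hA, zero_add,
    ← sum_filter_add_sum_filter_not (((interlacedBox u v).filter fun p => p.2 ≤ p.1).filter
      fun p => ¬ v + 2 ≤ p.1 + p.2) (fun p => u - v + p.2 + 1 ≤ p.1), hB, zero_add]
  refine sum_subset ?_ ?_
  · intro p hp
    simp only [interlacedPairs, mem_filter] at hp ⊢
    refine ⟨⟨⟨hp.1, ?_⟩, ?_⟩, ?_⟩ <;> omega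
  -- What is left over lies on the line `s + t = v + 1`, where rows 1 and 2 coincide.
  · intro p hp hp'
    simp only [interlacedPairs, mem_filter] at hp hp'
    refine columnDet_eq_zero_of_shifted_eq e _ (i := 1) (j := 2) (by decide) ?_
    have : p.1 + p.2 = v + 1 := by
      by_contra h
      exact hp' ⟨hp.1.1.1, by omega, by omega, by omega⟩
    simp; omega

/-! ### Permutation expansion: half planes and diagonals. -/

/-- A product of four entries, of total degree `u + v`. -/
def quadTerm (e : ℤ → R) (u v j : ℤ) (p : ℤ × ℤ) : R :=
  e (u - p.1 - j) * e (v - p.2 + j) * e p.1 * e p.2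

theorem finite_support_quadTerm {e : ℤ → R} (he : ∀ k < 0, e k = 0) (u v j : ℤ) :
    (Function.support (quadTerm e u v j)).Finite := by
  refine Set.Finite.subset (Icc 0 (u - j) ×ˢ Icc 0 (v + j)).finite_toSet ?_
  intro p hp
  by_contra h
  apply hp
  simp only [coe_product, coe_Icc, Set.mem_prod, Set.mem_Icc] at h
  unfold quadTerm
  by_cases h1 : p.1 < 0
  · simp [he _ h1]
  by_cases h2 : p.2 < 0
  · simp [he _ h2]
  by_cases h3 : u - p.1 - j < 0
  · simp [he _ h3]
  have h4 : v - p.2 + j < 0 := by omega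
  simp [he _ h4]

theorem finite_support_ite {α : Type*} {f : α → R} (hf : (Function.support f).Finite)
    (P : α → Prop) [DecidablePred P] : (Function.support fun p => if P p then f p else 0).Finite :=
  hf.subset fun p hp h => hp (by simp [h])

/-- Sum of `quadTerm` over a half plane. -/
noncomputable def halfPlaneSum (e : ℤ → R) (u v k j : ℤ) : R :=
  ∑ᶠ p : ℤ × ℤ, if p.2 + k ≤ p.1 then quadTerm e u v j p else 0

/-- Sum of `quadTerm` over a diagonal. -/
noncomputable def diagonalSum (e : ℤ → R) (u v k j : ℤ) : R :=
  ∑ᶠ p : ℤ × ℤ, if p.2 + k = p.1 then quadTerm e u v j p else 0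

theorem halfPlaneSum_eq {e : ℤ → R} (he : ∀ k < 0, e k = 0) (u v k j : ℤ) :
    halfPlaneSum e u v k j = diagonalSum e u v k j + halfPlaneSum e u v (k + 1) j := by
  have h := finite_support_quadTerm he u v j
  unfold halfPlaneSum diagonalSum
  rw [← finsum_add_distrib (finite_support_ite h _) (finite_support_ite h _)]
  refine finsum_congr fun p => ?_
  split_ifs <;> first | omega | simp

/-- Exchanging `s` and `t` fixes `e s * e t`; the change in the other two indices is absorbed into
`j`. -/
theorem diagonalSum_neg (e : ℤ → R) (u v k j : ℤ) :
    diagonalSum e u v (-k) j = diagonalSum e u v k (j - k) := by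
  unfold diagonalSum
  rw [← finsum_comp_equiv (Equiv.prodComm ℤ ℤ)]
  refine finsum_congr fun p => ?_
  change (if p.1 + -k = p.2 then quadTerm e u v j (p.2, p.1) else 0) = _
  simp only [quadTerm]
  by_cases h : p.2 + k = p.1
  · rw [if_pos h, if_pos (by omega)]
    have h1 : u - p.2 - j = u - p.1 - (j - k) := by omega
    have h2 : v - p.1 + j = v - p.2 + (j - k) := by omega
    rw [h1, h2]; ring
  · rw [if_neg h, if_neg (by omega)]

theorem diagonalSum_eq_finsum (e : ℤ → R) (u v k j : ℤ) :
    diagonalSum e u v k j = ∑ᶠ m : ℤ, quadTerm e u v j (m + k, m) := by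
  have hinj : Function.Injective (fun m : ℤ => (m + k, m)) := fun a b h => congrArg Prod.snd h
  rw [← finsum_mem_range (f := quadTerm e u v j) hinj]
  unfold diagonalSum
  classical
  refine finsum_congr fun p => ?_
  by_cases h : p.2 + k = p.1
  · rw [if_pos h, finsum_eq_if, if_pos ⟨p.2, by simp [h]⟩]
  · rw [if_neg h, finsum_eq_if, if_neg]
    rintro ⟨m, rfl⟩
    simp at h

/-- For each permutation, translating `(s, t)` by `(σ 2 - 2, σ 3 - 3)` normalises the last two
factors and moves the boundary of the half plane. Sums over all of `ℤ × ℤ` make this translation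
free of boundary terms. -/
theorem sum_filter_interlacedBox {e : ℤ → R} (he : ∀ k < 0, e k = 0) (u v : ℤ) :
    ∑ p ∈ (interlacedBox u v).filter (fun p => p.2 ≤ p.1), interlacedDet e u v p =
      ∑ σ : Equiv.Perm (Fin 4), ((Equiv.Perm.sign σ : ℤ) : R) *
        halfPlaneSum e u v ((σ 2 : ℤ) - (σ 3 : ℤ) + 1) (2 - (σ 0 : ℤ) - (σ 2 : ℤ)) := by
  have h1 : ∑ p ∈ (interlacedBox u v).filter (fun p => p.2 ≤ p.1), interlacedDet e u v p =
      ∑ᶠ p : ℤ × ℤ, if p.2 ≤ p.1 then interlacedDet e u v p else 0 := by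
    rw [sum_filter, finsum_eq_sum_of_support_subset]
    intro p hp
    by_contra h
    apply hp
    simp [interlacedDet_eq_zero he u v p h]
  have hσ : ∀ (σ : Equiv.Perm (Fin 4)) (p : ℤ × ℤ),
      quadTerm e u v (2 - (σ 0 : ℤ) - (σ 2 : ℤ)) (p.1 + ((σ 2 : ℤ) - 2), p.2 + ((σ 3 : ℤ) - 3)) =
        ∏ i, (Matrix.of fun i j : Fin 4 =>
          e ((![u - p.1, v - p.2, p.1, p.2] : Fin 4 → ℤ) i - (i : ℤ) + (j : ℤ))) i (σ i) := by
    intro σ p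
    -- This eliminates `σ 1`, so a single parameter `j` governs the first two factors.
    have hs : (σ 0 : ℤ) + (σ 1 : ℤ) + (σ 2 : ℤ) + (σ 3 : ℤ) = 6 := by
      have := Equiv.sum_comp σ (fun i : Fin 4 => ((i : ℕ) : ℤ))
      simpa [Fin.sum_univ_four] using this
    simp only [quadTerm, Fin.prod_univ_four, Matrix.of_apply]
    congr 1
    · congr 1
      · congr 1
        · congr 1; simp; ring
        · congr 1; simp; linarith
      · congr 1; simp; ring
    · congr 1; simp; ring
  have h2 : ∀ p : ℤ × ℤ, (if p.2 ≤ p.1 then interlacedDet e u v p else 0) =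
      ∑ σ : Equiv.Perm (Fin 4), (if p.2 ≤ p.1 then ((Equiv.Perm.sign σ : ℤ) : R) *
        quadTerm e u v (2 - (σ 0 : ℤ) - (σ 2 : ℤ))
          (p.1 + ((σ 2 : ℤ) - 2), p.2 + ((σ 3 : ℤ) - 3)) else 0) := by
    intro p
    split_ifs with h
    · unfold interlacedDet columnDet
      rw [← Matrix.det_transpose, Matrix.det_apply']
      refine sum_congr rfl fun σ _ => ?_
      rw [hσ]; rfl
    · simp
  have hfin : ∀ σ : Equiv.Perm (Fin 4), (Function.support fun p : ℤ × ℤ =>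
      ((Equiv.Perm.sign σ : ℤ) : R) * quadTerm e u v (2 - (σ 0 : ℤ) - (σ 2 : ℤ))
          (p.1 + ((σ 2 : ℤ) - 2), p.2 + ((σ 3 : ℤ) - 3))).Finite := by
    intro σ
    have := (finite_support_quadTerm he u v (2 - (σ 0 : ℤ) - (σ 2 : ℤ))).preimage
      (f := fun p : ℤ × ℤ => (p.1 + ((σ 2 : ℤ) - 2), p.2 + ((σ 3 : ℤ) - 3)))
      (Function.Injective.injOn (by rintro ⟨a, b⟩ ⟨c, d⟩ h; simpa using h))
    refine this.subset fun p hp h => hp ?_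
    simp [h]
  rw [h1, finsum_congr h2, finsum_sum_comm _ _ fun σ _ => finite_support_ite (hfin σ) _]
  refine sum_congr rfl fun σ _ => ?_
  rw [halfPlaneSum, mul_finsum' _ _ (finite_support_ite (finite_support_quadTerm he u v _) _)]
  refine Eq.trans (finsum_congr fun p => ?_) (finsum_comp_equiv
    ((Equiv.addRight ((σ 2 : ℤ) - 2)).prodCongr (Equiv.addRight ((σ 3 : ℤ) - 3))))
  change _ = _ * (if p.2 + ((σ 3 : ℤ) - 3) + ((σ 2 : ℤ) - (σ 3 : ℤ) + 1) ≤ p.1 + ((σ 2 : ℤ) - 2)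
    then quadTerm e u v (2 - (σ 0 : ℤ) - (σ 2 : ℤ))
      (p.1 + ((σ 2 : ℤ) - 2), p.2 + ((σ 3 : ℤ) - 3)) else 0)
  by_cases h : p.2 ≤ p.1
  · rw [if_pos h, if_pos (by omega)]
  · rw [if_neg h, if_neg (by omega), mul_zero]

/-- The two-column determinant `e_x e_y - e_{x+1} e_{y-1}`. -/
def pairDet (e : ℤ → R) (x y : ℤ) : R := e x * e y - e (x + 1) * e (y - 1)

theorem map_sign_perm_four : (univ : Finset (Equiv.Perm (Fin 4))).val.map
      (fun σ : Equiv.Perm (Fin 4) => ((Equiv.Perm.sign σ : ℤ), σ 0, σ 2, σ 3)) =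
      {(1, 0, 2, 3), (-1, 0, 3, 2), (-1, 0, 1, 3), (1, 0, 3, 1), (1, 0, 1, 2), (-1, 0, 2, 1),
        (-1, 1, 2, 3), (1, 1, 3, 2), (1, 1, 0, 3), (-1, 1, 3, 0), (-1, 1, 0, 2), (1, 1, 2, 0),
        (1, 2, 1, 3), (-1, 2, 3, 1), (-1, 2, 0, 3), (1, 2, 3, 0), (1, 2, 0, 1), (-1, 2, 1, 0),
        (-1, 3, 1, 2), (1, 3, 2, 1), (1, 3, 0, 2), (-1, 3, 2, 0), (-1, 3, 0, 1), (1, 3, 1, 0)} := by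
  decide +kernel

/-- Exchanging the values `σ 0` and `σ 2` reverses the sign but keeps `j = 2 - σ 0 - σ 2`. Hence for
each `j` the half planes cancel up to finitely many diagonals. -/
theorem sum_interlacedDet {e : ℤ → R} (he : ∀ k < 0, e k = 0) {u v : ℤ} (huv : v ≤ u) :
    ∑ p ∈ interlacedPairs u v, interlacedDet e u v p =
      diagonalSum e u v 0 0 - diagonalSum e u v 2 (-1) - diagonalSum e u v 0 (-2)
        + diagonalSum e u v 2 (-3) - diagonalSum e u v 1 (-1) + diagonalSum e u v 3 (-2)
        + diagonalSum e u v 1 (-2) - diagonalSum e u v 3 (-3) := by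
  rw [sum_interlacedPairs e huv, sum_filter_interlacedBox he]
  have hsum : ∀ f : ℤ → Fin 4 → Fin 4 → Fin 4 → R,
      ∑ σ : Equiv.Perm (Fin 4), f (Equiv.Perm.sign σ : ℤ) (σ 0) (σ 2) (σ 3) =
        (((univ : Finset (Equiv.Perm (Fin 4))).val.map
          (fun σ : Equiv.Perm (Fin 4) => ((Equiv.Perm.sign σ : ℤ), σ 0, σ 2, σ 3))).map
            fun x => f x.1 x.2.1 x.2.2.1 x.2.2.2).sum := by
    intro f
    rw [Multiset.map_map]; rfl
  rw [hsum fun ε a b c => (ε : R) * halfPlaneSum e u v ((b : ℤ) - (c : ℤ) + 1)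
    (2 - (a : ℤ) - (b : ℤ)), map_sign_perm_four]
  -- The offset `σ 2 - σ 3 + 1` lies between -2 and 4. Every half plane is peeled to offset 4, and
  -- `s1`, `s2` fold the negative diagonals onto positive ones.
  have h3 := fun j => halfPlaneSum_eq he u v 3 j
  have h2 := fun j => halfPlaneSum_eq he u v 2 j
  have h1 := fun j => halfPlaneSum_eq he u v 1 j
  have h0 := fun j => halfPlaneSum_eq he u v 0 j
  have hm1 := fun j => halfPlaneSum_eq he u v (-1) j
  have hm2 := fun j => halfPlaneSum_eq he u v (-2) j
  have s1 := fun j => diagonalSum_neg e u v 1 j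
  have s2 := fun j => diagonalSum_neg e u v 2 j
  norm_num at h3 h2 h1 h0 hm1 hm2 s1 s2
  simp only [Multiset.insert_eq_cons, Multiset.map_cons, Multiset.sum_cons, Multiset.map_singleton,
    Multiset.sum_singleton]
  norm_num [hm2, hm1, h0, h1, h2, h3, s1, s2]
  ring

theorem diagonalSum_eq_sum {e : ℤ → R} (he : ∀ k < 0, e k = 0) (u v k l j : ℤ) {S : Finset ℤ}
    (hS : Icc (-l) (v + j - l) ⊆ S) :
    diagonalSum e u v k j = ∑ m ∈ S, quadTerm e u v j (m + l + k, m + l) := by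
  rw [diagonalSum_eq_finsum, ← finsum_comp_equiv (Equiv.addRight l)]
  refine finsum_eq_sum_of_support_subset _ fun m hm => hS (mem_Icc.2 ?_)
  by_contra h
  apply hm
  change quadTerm e u v j (m + l + k, m + l) = 0
  unfold quadTerm
  by_cases h1 : m + l < 0
  · simp [he _ h1]
  · have h2 : v - (m + l) + j < 0 := by omega
    simp [he _ h2]

/-- The first two products share the factor `pairDet e m m` and two of their terms cancel, leaving
eight monomials. Shifting the diagonals by `l = 0` or `l = -1` matches these monomials term by term.
-/
theorem sum_pairDet_mul {e : ℤ → R} (he : ∀ k < 0, e k = 0) {u v : ℤ} (huv : v ≤ u)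
    {S : Finset ℤ} (hS : Icc (-1) v ⊆ S) :
    ∑ m ∈ S, (pairDet e (u - m + 1) (v - m - 1) * pairDet e m m
        + pairDet e (u - m) (v - m) * pairDet e m m
        - pairDet e (u - m) (v - m - 1) * pairDet e (m + 1) m) =
      ∑ p ∈ interlacedPairs u v, interlacedDet e u v p := by
  have hd : ∀ k l j : ℤ, l ≤ 1 → j - l ≤ 0 → diagonalSum e u v k j =
      ∑ m ∈ S, quadTerm e u v j (m + l + k, m + l) := fun k l j h1 h2 =>
    diagonalSum_eq_sum he u v k l j ((Icc_subset_Icc (by omega) (by omega)).trans hS)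
  rw [sum_interlacedDet he huv, hd 0 0 0, hd 2 (-1) (-1), hd 0 0 (-2), hd 2 (-1) (-3), hd 1 0 (-1),
    hd 3 (-1) (-2), hd 1 0 (-2), hd 3 (-1) (-3)]
  any_goals norm_num
  simp only [← sum_add_distrib, ← sum_sub_distrib]
  refine sum_congr rfl fun m _ => ?_
  unfold pairDet quadTerm
  ring_nf

end Algebra

/-! ### Tableaux and removal of the largest entry. -/

namespace SemistandardYoungTableau

theorem entry_lt_of_weight {μ : YoungDiagram} (T : SemistandardYoungTableau μ) {n : ℕ}
    (h : T.weight.support ⊆ range n) {i j : ℕ} (hij : (i, j) ∈ μ) : T i j < n := by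
  refine mem_range.1 (h (Finsupp.mem_support_iff.2 ?_))
  rw [weight_apply]
  exact card_ne_zero_of_mem (mem_filter.2 ⟨(YoungDiagram.mem_cells _).2 hij, rfl⟩)

theorem weight_apply_eq_zero {μ : YoungDiagram} (T : SemistandardYoungTableau μ) {n : ℕ}
    (h : ∀ i j, (i, j) ∈ μ → T i j < n) {m : ℕ} (hm : n ≤ m) : T.weight m = 0 := by
  rw [weight_apply, card_eq_zero, filter_eq_empty_iff]
  rintro ⟨i, j⟩ hij
  exact ((h i j ((YoungDiagram.mem_cells _).1 hij)).trans_le hm).ne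

/-- If `T` extends `T'` by cells filled with `n`, then its weight is that of `T'` plus the number
of new cells at `n`. -/
theorem weight_eq_add_single {μ ν : YoungDiagram} (hνμ : ν ≤ μ) (T : SemistandardYoungTableau μ)
    (T' : SemistandardYoungTableau ν) (n : ℕ) (hT : ∀ i j, (i, j) ∈ ν → T i j = T' i j)
    (hn : ∀ i j, (i, j) ∈ μ → (i, j) ∉ ν → T i j = n) :
    T.weight = T'.weight + Finsupp.single n (μ.cells \ ν.cells).card := by
  have hsub : ν.cells ⊆ μ.cells := hνμ
  rw [weight, weight, ← sum_sdiff hsub, add_comm]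
  congr 1
  · refine sum_congr rfl ?_
    rintro ⟨i, j⟩ hij
    rw [hT i j ((YoungDiagram.mem_cells _).1 hij)]
  · rw [sum_congr rfl (g := fun _ => Finsupp.single n 1)]
    · simp
    · rintro ⟨i, j⟩ hij
      rw [mem_sdiff, YoungDiagram.mem_cells, YoungDiagram.mem_cells] at hij
      rw [hn i j hij.1 hij.2]

/-- The restriction of a tableau to a smaller diagram. -/
def restrict {μ ν : YoungDiagram} (hνμ : ν ≤ μ) (T : SemistandardYoungTableau μ) :
    SemistandardYoungTableau ν where
  entry i j := if (i, j) ∈ ν then T i j else 0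
  row_weak' {i j1 j2} hj h := by
    rw [if_pos h, if_pos (ν.up_left_mem le_rfl hj.le h)]
    exact T.row_weak hj (hνμ h)
  col_strict' {i1 i2 j} hi h := by
    rw [if_pos h, if_pos (ν.up_left_mem hi.le le_rfl h)]
    exact T.col_strict hi (hνμ h)
  zeros' h := if_neg h

theorem restrict_apply {μ ν : YoungDiagram} (hνμ : ν ≤ μ) (T : SemistandardYoungTableau μ)
    {i j : ℕ} (h : (i, j) ∈ ν) : T.restrict hνμ i j = T i j := if_pos h

/-- The extension of a tableau by a horizontal strip of cells filled with `n`. -/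
def extend {μ ν : YoungDiagram} (hνμ : ν ≤ μ)
    (hstrip : ∀ i₁ i₂ j, i₁ < i₂ → (i₂, j) ∈ μ → (i₁, j) ∈ ν) (n : ℕ)
    (T : SemistandardYoungTableau ν) (hT : ∀ i j, (i, j) ∈ ν → T i j < n) :
    SemistandardYoungTableau μ where
  entry i j := if (i, j) ∈ ν then T i j else if (i, j) ∈ μ then n else 0
  row_weak' {i j1 j2} hj h := by
    by_cases h2 : (i, j2) ∈ ν
    · rw [if_pos h2, if_pos (ν.up_left_mem le_rfl hj.le h2)]
      exact T.row_weak hj h2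
    · rw [if_neg h2, if_pos h]
      split_ifs with h3
      · exact (hT _ _ h3).le
      · exact le_rfl
      · exact Nat.zero_le _
  col_strict' {i1 i2 j} hi h := by
    rw [if_pos (hstrip _ _ _ hi h)]
    by_cases h2 : (i2, j) ∈ ν
    · rw [if_pos h2]
      exact T.col_strict hi h2
    · rw [if_neg h2, if_pos h]
      exact hT _ _ (hstrip _ _ _ hi h)
  zeros' h := by rw [if_neg fun h' => h (hνμ h'), if_neg h]

theorem extend_apply_of_mem {μ ν : YoungDiagram} (hνμ : ν ≤ μ)
    (hstrip : ∀ i₁ i₂ j, i₁ < i₂ → (i₂, j) ∈ μ → (i₁, j) ∈ ν) (n : ℕ)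
    (T : SemistandardYoungTableau ν) (hT : ∀ i j, (i, j) ∈ ν → T i j < n) {i j : ℕ}
    (h : (i, j) ∈ ν) : extend hνμ hstrip n T hT i j = T i j := if_pos h

theorem extend_apply_of_notMem {μ ν : YoungDiagram} (hνμ : ν ≤ μ)
    (hstrip : ∀ i₁ i₂ j, i₁ < i₂ → (i₂, j) ∈ μ → (i₁, j) ∈ ν) (n : ℕ)
    (T : SemistandardYoungTableau ν) (hT : ∀ i j, (i, j) ∈ ν → T i j < n) {i j : ℕ}
    (hμ : (i, j) ∈ μ) (h : (i, j) ∉ ν) : extend hνμ hstrip n T hT i j = n :=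
  (if_neg h).trans (if_pos hμ)

theorem support_erase_subset {d : ℕ →₀ ℕ} {n : ℕ} (hd : d.support ⊆ range (n + 1)) :
    (d.erase n).support ⊆ range n := by
  intro i hi
  rw [Finsupp.support_erase, mem_erase] at hi
  have := mem_range.1 (hd hi.2)
  exact mem_range.2 (by omega)

/-- Removing the cells filled with the largest entry `n` of a tableau. -/
def removeLargestEquiv {μ ν : YoungDiagram} (hνμ : ν ≤ μ)
    (hstrip : ∀ i₁ i₂ j, i₁ < i₂ → (i₂, j) ∈ μ → (i₁, j) ∈ ν) {n : ℕ} {d : ℕ →₀ ℕ}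
    (hd : d.support ⊆ range (n + 1)) (hcard : d n = (μ.cells \ ν.cells).card) :
    {T : SemistandardYoungTableau μ //
      T.weight = d ∧ ∀ i j, (i, j) ∈ μ → (T i j < n ↔ (i, j) ∈ ν)} ≃
    {T : SemistandardYoungTableau ν // T.weight = d.erase n} where
  toFun T := ⟨T.1.restrict hνμ, by
    have hw := weight_eq_add_single hνμ T.1 (T.1.restrict hνμ) n
      (fun i j h => (restrict_apply hνμ T.1 h).symm) (fun i j h h' => by
        have h1 : T.1 i j < n + 1 := entry_lt_of_weight T.1 (by rw [T.2.1]; exact hd) h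
        have h2 := mt (T.2.2 i j h).1 h'
        omega)
    rw [T.2.1] at hw
    have h0 : (T.1.restrict hνμ).weight n = 0 :=
      weight_apply_eq_zero _ (fun i j h => by
        rw [restrict_apply hνμ T.1 h]; exact (T.2.2 i j (hνμ h)).2 h) le_rfl
    refine Eq.trans ?_ (congrArg (Finsupp.erase n) hw).symm
    rw [Finsupp.erase_add, Finsupp.erase_single, add_zero]
    exact (Finsupp.erase_of_notMem_support (by simpa using h0)).symm⟩
  invFun T :=
    have hT : ∀ i j, (i, j) ∈ ν → T.1 i j < n := fun i j h =>
      entry_lt_of_weight T.1 (by rw [T.2]; exact support_erase_subset hd) h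
    ⟨extend hνμ hstrip n T.1 hT, by
      rw [weight_eq_add_single hνμ _ T.1 n (fun i j h => extend_apply_of_mem hνμ hstrip n T.1 hT h)
        (fun i j h h' => extend_apply_of_notMem hνμ hstrip n T.1 hT h h'), T.2, ← hcard]
      exact Finsupp.erase_add_single n d, fun i j h => by
      by_cases h' : (i, j) ∈ ν
      · rw [extend_apply_of_mem hνμ hstrip n T.1 hT h']
        exact iff_of_true (hT i j h') h'
      · rw [extend_apply_of_notMem hνμ hstrip n T.1 hT h h']
        exact iff_of_false (lt_irrefl n) h'⟩
  left_inv T := by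
    apply Subtype.ext
    ext i j
    by_cases h' : (i, j) ∈ ν
    · exact (if_pos h').trans (if_pos h')
    · by_cases h : (i, j) ∈ μ
      · refine ((if_neg h').trans (if_pos h)).trans ?_
        have h1 : T.1 i j < n + 1 := entry_lt_of_weight T.1 (by rw [T.2.1]; exact hd) h
        have h2 := mt (T.2.2 i j h).1 h'
        omega
      · exact (zeros _ h).trans (zeros _ h).symm
  right_inv T := by
    apply Subtype.ext
    ext i j
    by_cases h' : (i, j) ∈ ν
    · exact (if_pos h').trans (if_pos h')
    · exact (zeros _ h').trans (zeros _ h').symm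

end SemistandardYoungTableau

/-! ### Diagrams with prescribed column lengths and the branching count. -/

section ColumnDiagram

variable {N : ℕ}

open Classical in
/-- The Young diagram whose columns have the lengths `c 0 ≥ c 1 ≥ ⋯`. -/
noncomputable def columnDiagram (c : Fin N → ℤ) : YoungDiagram where
  cells := (range (univ.sup fun j => (c j).toNat) ×ˢ range N).filter fun p =>
    ∀ k : Fin N, (k : ℕ) ≤ p.2 → (p.1 : ℤ) < c k
  isLowerSet := by
    rintro ⟨i, j⟩ ⟨i', j'⟩ ⟨hi : i' ≤ i, hj : j' ≤ j⟩ h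
    simp only [coe_filter, mem_product, mem_range, Set.mem_ofPred_eq] at h ⊢
    refine ⟨⟨hi.trans_lt h.1.1, hj.trans_lt h.1.2⟩, fun k hk => ?_⟩
    have := h.2 k (hk.trans hj)
    omega

theorem mem_columnDiagram {c : Fin N → ℤ} (hc : Antitone c) (i : ℕ) (j : Fin N) :
    (i, (j : ℕ)) ∈ columnDiagram c ↔ (i : ℤ) < c j := by
  rw [← YoungDiagram.mem_cells]
  simp only [columnDiagram, mem_filter, mem_product, mem_range]
  constructor
  · exact fun h => h.2 j le_rfl
  · intro h
    refine ⟨⟨?_, j.2⟩, fun k hk => h.trans_le (hc hk)⟩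
    exact lt_of_lt_of_le (by omega) (le_sup (f := fun j => (c j).toNat) (mem_univ j))

theorem lt_of_mem_columnDiagram {c : Fin N → ℤ} {i j : ℕ} (h : (i, j) ∈ columnDiagram c) :
    j < N := by
  rw [← YoungDiagram.mem_cells] at h
  simp only [columnDiagram, mem_filter, mem_product, mem_range] at h
  exact h.1.2

/-- Shortening by one the columns in `s`. -/
def shortenColumns (c : Fin N → ℤ) (s : Finset (Fin N)) (j : Fin N) : ℤ :=
  c j - if j ∈ s then 1 else 0

/-- Sequences of column lengths of Young diagrams. -/
def IsColumnSeq (c : Fin N → ℤ) : Prop := Antitone c ∧ ∀ j, 0 ≤ c j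

variable {c : Fin N → ℤ} {s : Finset (Fin N)}

theorem columnDiagram_shortenColumns_le (hc : IsColumnSeq c)
    (hs : IsColumnSeq (shortenColumns c s)) :
    columnDiagram (shortenColumns c s) ≤ columnDiagram c := by
  rintro ⟨i, j⟩ h
  obtain ⟨j, rfl⟩ : ∃ j' : Fin N, (j' : ℕ) = j := ⟨⟨j, lt_of_mem_columnDiagram h⟩, rfl⟩
  rw [mem_columnDiagram hs.1] at h
  rw [mem_columnDiagram hc.1]
  unfold shortenColumns at h
  split_ifs at h <;> omega

theorem columnDiagram_strip (hc : IsColumnSeq c) (hs : IsColumnSeq (shortenColumns c s))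
    (i₁ i₂ j : ℕ) (hi : i₁ < i₂) (h : (i₂, j) ∈ columnDiagram c) :
    (i₁, j) ∈ columnDiagram (shortenColumns c s) := by
  obtain ⟨j, rfl⟩ : ∃ j' : Fin N, (j' : ℕ) = j := ⟨⟨j, lt_of_mem_columnDiagram h⟩, rfl⟩
  rw [mem_columnDiagram hc.1] at h
  rw [mem_columnDiagram hs.1]
  unfold shortenColumns
  split_ifs <;> omega

theorem mem_columnDiagram_diff_iff (hc : IsColumnSeq c) (hs : IsColumnSeq (shortenColumns c s))
    (i : ℕ) (j : Fin N) :
    ((i, (j : ℕ)) ∈ columnDiagram c ∧ (i, (j : ℕ)) ∉ columnDiagram (shortenColumns c s)) ↔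
      j ∈ s ∧ (i : ℤ) = c j - 1 := by
  rw [mem_columnDiagram hc.1, mem_columnDiagram hs.1]
  unfold shortenColumns
  split_ifs with h
  · simp only [h, true_and]
    omega
  · simp only [h, false_and, iff_false]
    omega

theorem card_columnDiagram_diff (hc : IsColumnSeq c) (hs : IsColumnSeq (shortenColumns c s)) :
    ((columnDiagram c).cells \ (columnDiagram (shortenColumns c s)).cells).card = s.card := by
  symm
  refine card_bij (fun j _ => ((c j - 1).toNat, (j : ℕ))) ?_ ?_ ?_
  · intro j hj
    rw [mem_sdiff, YoungDiagram.mem_cells, YoungDiagram.mem_cells,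
      mem_columnDiagram_diff_iff hc hs]
    have := hs.2 j
    rw [shortenColumns, if_pos hj] at this
    exact ⟨hj, by omega⟩
  · intro j _ k _ h
    exact Fin.ext (congrArg Prod.snd h)
  · rintro ⟨i, j⟩ h
    rw [mem_sdiff, YoungDiagram.mem_cells, YoungDiagram.mem_cells] at h
    obtain ⟨j, rfl⟩ : ∃ j' : Fin N, (j' : ℕ) = j := ⟨⟨j, lt_of_mem_columnDiagram h.1⟩, rfl⟩
    rw [mem_columnDiagram_diff_iff hc hs] at h
    exact ⟨j, h.1, by simp [← h.2]⟩

open Classical in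
/-- The columns of a tableau that contain the entry `n`. -/
noncomputable def columnsWith (T : SemistandardYoungTableau (columnDiagram c)) (n : ℕ) :
    Finset (Fin N) :=
  univ.filter fun j => ∃ i : ℕ, (i, (j : ℕ)) ∈ columnDiagram c ∧ T i j = n

theorem mem_columnsWith (T : SemistandardYoungTableau (columnDiagram c)) (n : ℕ) (j : Fin N) :
    j ∈ columnsWith T n ↔ ∃ i : ℕ, (i, (j : ℕ)) ∈ columnDiagram c ∧ T i j = n := by
  simp [columnsWith]

theorem mem_columnsWith_iff (hc : IsColumnSeq c) {T : SemistandardYoungTableau (columnDiagram c)}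
    {n : ℕ} (hT : ∀ i j, (i, j) ∈ columnDiagram c → T i j ≤ n) {i : ℕ} {j : Fin N}
    (hi : (i : ℤ) = c j - 1) : j ∈ columnsWith T n ↔ T i j = n := by
  have hmem : (i, (j : ℕ)) ∈ columnDiagram c := by rw [mem_columnDiagram hc.1]; omega
  rw [mem_columnsWith]
  constructor
  · rintro ⟨i', h', hn⟩
    have h1 := (mem_columnDiagram hc.1 _ _).1 h'
    have h2 := T.col_weak (i1 := i') (i2 := i) (by omega) hmem
    have h3 := hT i j hmem
    omega
  · exact fun h => ⟨i, hmem, h⟩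

/-- Only a tie could break monotonicity: if a column ends in the maximal entry `n`, then so does
every column of equal length to its right, by weak increase along the row. -/
theorem isColumnSeq_shortenColumns_columnsWith (hc : IsColumnSeq c)
    {T : SemistandardYoungTableau (columnDiagram c)}
    {n : ℕ} (hT : ∀ i j, (i, j) ∈ columnDiagram c → T i j ≤ n) :
    IsColumnSeq (shortenColumns c (columnsWith T n)) := by
  have hpos : ∀ j ∈ columnsWith T n, 0 < c j := by
    intro j hj
    obtain ⟨i, hi, -⟩ := (mem_columnsWith T n j).1 hj
    have := (mem_columnDiagram hc.1 _ _).1 hi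
    omega
  constructor
  · intro j k hjk
    have hle := hc.1 hjk
    unfold shortenColumns
    by_cases hj : j ∈ columnsWith T n
    · rw [if_pos hj]
      rcases hle.lt_or_eq with h | h
      · split_ifs <;> omega
      · have h0 := hpos j hj
        have hi : (((c j - 1).toNat : ℕ) : ℤ) = c j - 1 := by omega
        have hn := (mem_columnsWith_iff hc hT hi).1 hj
        have hmem : ((c j - 1).toNat, (k : ℕ)) ∈ columnDiagram c := by
          rw [mem_columnDiagram hc.1]; omega
        have h1 := T.row_weak_of_le hjk hmem
        have h2 := hT _ _ hmem
        have hk : k ∈ columnsWith T n :=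
          (mem_columnsWith_iff hc hT (i := (c j - 1).toNat) (by omega)).2 (by omega)
        rw [if_pos hk, h]
    · rw [if_neg hj]
      split_ifs <;> omega
  · intro j
    unfold shortenColumns
    have := hc.2 j
    split_ifs with h
    · have := hpos j h
      omega
    · omega

theorem columnsWith_eq_iff (hc : IsColumnSeq c) (hs : IsColumnSeq (shortenColumns c s))
    {T : SemistandardYoungTableau (columnDiagram c)}
    {n : ℕ} (hT : ∀ i j, (i, j) ∈ columnDiagram c → T i j ≤ n) :
    columnsWith T n = s ↔ ∀ i j, (i, j) ∈ columnDiagram c →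
      (T i j < n ↔ (i, j) ∈ columnDiagram (shortenColumns c s)) := by
  constructor
  · rintro rfl i j h
    obtain ⟨j, rfl⟩ : ∃ j' : Fin N, (j' : ℕ) = j := ⟨⟨j, lt_of_mem_columnDiagram h⟩, rfl⟩
    have h1 := mem_columnDiagram_diff_iff hc hs i j
    have h2 := hT i j h
    have h3 : T i j = n ↔ j ∈ columnsWith T n ∧ (i : ℤ) = c j - 1 := by
      constructor
      · intro h4
        have h5 : j ∈ columnsWith T n := (mem_columnsWith T n j).2 ⟨i, h, h4⟩
        refine ⟨h5, ?_⟩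
        by_contra h6
        have h7 := (mem_columnDiagram hc.1 _ _).1 h
        have h8 : (i + 1, (j : ℕ)) ∈ columnDiagram c := by
          rw [mem_columnDiagram hc.1]; push_cast; omega
        have h9 := T.col_strict (Nat.lt_succ_self i) h8
        have h10 := hT _ _ h8
        simp only [Nat.succ_eq_add_one] at h9
        omega
      · exact fun h4 => (mem_columnsWith_iff hc hT h4.2).1 h4.1
    rw [← h3] at h1
    simp only [h, true_and] at h1
    rw [← not_iff_not, h1]
    omega
  · intro h
    ext j
    rcases (hc.2 j).eq_or_lt with h0 | h0
    · refine iff_of_false (fun hj => ?_) (fun hj => ?_)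
      · obtain ⟨i, hi, -⟩ := (mem_columnsWith T n j).1 hj
        have := (mem_columnDiagram hc.1 _ _).1 hi
        omega
      · have := hs.2 j
        rw [shortenColumns, if_pos hj] at this
        omega
    · have hi : (((c j - 1).toNat : ℕ) : ℤ) = c j - 1 := by omega
      have hmem : ((c j - 1).toNat, (j : ℕ)) ∈ columnDiagram c := by
        rw [mem_columnDiagram hc.1]; omega
      rw [mem_columnsWith_iff hc hT hi]
      have h1 := h _ _ hmem
      have h2 := mem_columnDiagram_diff_iff hc hs (c j - 1).toNat j
      have h3 := hT _ _ hmem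
      rw [← h1] at h2
      simp only [hmem, hi, true_and, and_true] at h2
      rw [← h2]
      omega

open Classical in
-- Tableaux are sorted by the set of columns containing `n`; strictness down columns allows at most
-- one `n` in each.
theorem card_tableaux_eq_sum (hc : IsColumnSeq c) {n : ℕ} {d : ℕ →₀ ℕ}
    (hd : d.support ⊆ range (n + 1)) :
    Nat.card {T : SemistandardYoungTableau (columnDiagram c) // T.weight = d} =
      ∑ s : Finset (Fin N), if IsColumnSeq (shortenColumns c s) ∧ d n = s.card then
        Nat.card {T : SemistandardYoungTableau (columnDiagram (shortenColumns c s)) //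
          T.weight = d.erase n} else 0 := by
  have hT : ∀ T : {T : SemistandardYoungTableau (columnDiagram c) // T.weight = d},
      ∀ i j, (i, j) ∈ columnDiagram c → T.1 i j ≤ n := fun T i j h =>
    Nat.lt_succ_iff.1 (T.1.entry_lt_of_weight (by rw [T.2]; exact hd) h)
  have := SemistandardYoungTableau.finite_weight_eq (columnDiagram c) d
  rw [← Nat.card_congr (Equiv.sigmaFiberEquiv
    fun T : {T : SemistandardYoungTableau (columnDiagram c) // T.weight = d} =>
      columnsWith T.1 n), Nat.card_sigma]
  refine sum_congr rfl fun s _ => ?_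
  split_ifs with h
  · have hcard := h.2.trans (card_columnDiagram_diff hc h.1).symm
    rw [← Nat.card_congr (SemistandardYoungTableau.removeLargestEquiv
      (columnDiagram_shortenColumns_le hc h.1) (columnDiagram_strip hc h.1) hd hcard)]
    refine Nat.card_congr ((Equiv.subtypeSubtypeEquivSubtypeInter
      (fun T : SemistandardYoungTableau (columnDiagram c) => T.weight = d)
      (fun T => columnsWith T n = s)).trans (Equiv.subtypeEquivRight fun T => ?_))
    refine and_congr_right fun hw => ?_
    exact columnsWith_eq_iff hc h.1 (hT ⟨T, hw⟩)
  · rw [Nat.card_eq_zero]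
    left
    refine ⟨fun T => h ?_⟩
    have hs : IsColumnSeq (shortenColumns c s) := by
      have := isColumnSeq_shortenColumns_columnsWith hc (hT T.1)
      rwa [T.2] at this
    refine ⟨hs, ?_⟩
    rw [← card_columnDiagram_diff hc hs, ← T.1.2, SemistandardYoungTableau.weight_apply]
    congr 1
    ext ⟨i, j⟩
    rw [mem_filter, mem_sdiff, YoungDiagram.mem_cells, YoungDiagram.mem_cells]
    refine and_congr_right fun hij => ?_
    rw [← (columnsWith_eq_iff hc hs (hT T.1)).1 T.2 i j hij]
    have := hT T.1 i j hij
    simp only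
    omega

end ColumnDiagram

/-! ### Determinant recursion, elementary series and truncation of variables. -/

theorem columnDet_add_mul {R : Type*} [CommRing R] {N : ℕ} (e : ℤ → R) (x : R) (c : Fin N → ℤ) :
    columnDet (fun k => e k + x * e (k - 1)) c =
      ∑ s : Finset (Fin N), x ^ s.card * columnDet e (shortenColumns c s) := by
  -- Each row is split in two; choosing the `x` part in row `i` amounts to replacing `c i` by `c i -
  -- 1`.
  have h := (Matrix.detRowAlternating (R := R) (n := Fin N)).toMultilinearMap.map_add_univ
    (fun i j => x * e (c i - 1 - (i : ℤ) + (j : ℤ))) (fun i j => e (c i - (i : ℤ) + (j : ℤ)))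
  have h1 : columnDet (fun k => e k + x * e (k - 1)) c =
      (Matrix.detRowAlternating (R := R) (n := Fin N)).toMultilinearMap
        ((fun (i j : Fin N) => x * e (c i - 1 - (i : ℤ) + (j : ℤ))) +
          fun (i j : Fin N) => e (c i - (i : ℤ) + (j : ℤ))) := by
    change Matrix.det _ = Matrix.det _
    congr 1
    ext i j
    have : c i - (i : ℤ) + (j : ℤ) - 1 = c i - 1 - (i : ℤ) + (j : ℤ) := by ring
    simp [this, add_comm]
  rw [h1, h]
  refine sum_congr rfl fun s _ => ?_
  have h2 := (Matrix.detRowAlternating (R := R) (n := Fin N)).toMultilinearMap.map_piecewise_smul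
    (fun _ => x) (fun i j => e (shortenColumns c s i - (i : ℤ) + (j : ℤ))) s
  rw [prod_const, smul_eq_mul] at h2
  refine Eq.trans ?_ h2
  congr 1
  ext i j
  by_cases hi : i ∈ s <;> simp [hi, shortenColumns]

/-- The elementary symmetric function of degree `k` in the first `n` variables. -/
noncomputable def elementarySeries : ℕ → ℤ → MvPowerSeries ℕ ℤ
  | 0, k => if k = 0 then 1 else 0
  | n + 1, k => elementarySeries n k + MvPowerSeries.X n * elementarySeries n (k - 1)

theorem elementarySeries_of_neg (n : ℕ) : ∀ k < 0, elementarySeries n k = 0 := by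
  induction n with
  | zero => exact fun k hk => if_neg hk.ne
  | succ n ih =>
    intro k hk
    rw [elementarySeries, ih k hk, ih (k - 1) (by omega), mul_zero, add_zero]

/-- Setting to zero all variables except the first `n`. -/
noncomputable def truncVars (n : ℕ) : MvPowerSeries ℕ ℤ →+* MvPowerSeries ℕ ℤ where
  toFun f := fun d => if d.support ⊆ range n then f d else 0
  map_one' := by
    ext d
    change (if d.support ⊆ range n then MvPowerSeries.coeff d 1 else 0) = _
    rw [MvPowerSeries.coeff_one]
    split_ifs with h1 h2 h2 <;> simp_all
  map_zero' := by
    ext d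
    exact ite_self _
  map_add' f g := by
    ext d
    change (if d.support ⊆ range n then f d + g d else 0) =
      (if d.support ⊆ range n then f d else 0) + (if d.support ⊆ range n then g d else 0)
    split_ifs <;> simp
  map_mul' f g := by
    ext d
    have hmul : ∀ F G : MvPowerSeries ℕ ℤ, MvPowerSeries.coeff d (F * G) =
        ∑ p ∈ antidiagonal d, F p.1 * G p.2 := fun F G => MvPowerSeries.coeff_mul d F G
    refine Eq.trans ?_ (hmul _ _).symm
    change (if d.support ⊆ range n then MvPowerSeries.coeff d (f * g) else 0) =
      ∑ p ∈ antidiagonal d, (if p.1.support ⊆ range n then f p.1 else 0) *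
        (if p.2.support ⊆ range n then g p.2 else 0)
    have hsupp : ∀ p ∈ antidiagonal d,
        (d.support ⊆ range n ↔ p.1.support ⊆ range n ∧ p.2.support ⊆ range n) := by
      intro p hp
      rw [← mem_antidiagonal.1 hp, ← union_subset_iff]
      have : (p.1 + p.2).support = p.1.support ∪ p.2.support := by
        ext i
        simp only [Finsupp.mem_support_iff, Finsupp.add_apply, mem_union]
        omega
      rw [this]
    rw [hmul]
    split_ifs with h
    · refine sum_congr rfl fun p hp => ?_
      have := (hsupp p hp).1 h
      rw [if_pos this.1, if_pos this.2]
    · refine (sum_eq_zero fun p hp => ?_).symm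
      have := mt (hsupp p hp).2 h
      by_cases h1 : p.1.support ⊆ range n
      · rw [if_neg fun h2 => this ⟨h1, h2⟩, mul_zero]
      · rw [if_neg h1, zero_mul]

theorem coeff_truncVars (n : ℕ) (f : MvPowerSeries ℕ ℤ) (d : ℕ →₀ ℕ) :
    MvPowerSeries.coeff d (truncVars n f) =
      if d.support ⊆ range n then MvPowerSeries.coeff d f else 0 := rfl

theorem eq_of_truncVars_eq {f g : MvPowerSeries ℕ ℤ} (h : ∀ n, truncVars n f = truncVars n g) :
    f = g := by
  ext d
  have := congrArg (MvPowerSeries.coeff d) (h (d.support.sup id + 1))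
  rw [coeff_truncVars, coeff_truncVars] at this
  have hd : d.support ⊆ range (d.support.sup id + 1) := fun i hi =>
    mem_range.2 (Nat.lt_succ_of_le (le_sup (f := id) hi))
  rwa [if_pos hd, if_pos hd] at this

theorem coeff_X_pow_mul_truncVars (n k : ℕ) (f : MvPowerSeries ℕ ℤ) (d : ℕ →₀ ℕ) :
    MvPowerSeries.coeff d (MvPowerSeries.X n ^ k * truncVars n f) =
      if d.support ⊆ range (n + 1) ∧ d n = k then MvPowerSeries.coeff (d.erase n) f else 0 := by
  rw [MvPowerSeries.X_pow_eq, MvPowerSeries.coeff_monomial_mul, coeff_truncVars, one_mul,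
    ← ite_and]
  by_cases h : d.support ⊆ range (n + 1) ∧ d n = k
  · have hd : d - Finsupp.single n k = d.erase n := by
      rw [← h.2]
      nth_rw 1 [← Finsupp.erase_add_single n d]
      exact add_tsub_cancel_right _ _
    rw [if_pos h, hd, if_pos]
    exact ⟨Finsupp.single_le_iff.2 h.2.ge,
      SemistandardYoungTableau.support_erase_subset h.1⟩
  · rw [if_neg h, if_neg]
    rintro ⟨h1, h2⟩
    apply h
    have hk : d n = k := by
      refine le_antisymm ?_ (Finsupp.single_le_iff.1 h1)
      by_contra h3
      have : n ∈ (d - Finsupp.single n k).support := by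
        rw [Finsupp.mem_support_iff, Finsupp.tsub_apply, Finsupp.single_eq_same]
        omega
      simpa using h2 this
    refine ⟨fun i hi => ?_, hk⟩
    rcases eq_or_ne i n with rfl | hin
    · simp
    · have : i ∈ (d - Finsupp.single n k).support := by
        rw [Finsupp.mem_support_iff, Finsupp.tsub_apply, Finsupp.single_eq_of_ne hin]
        simpa using hi
      have := mem_range.1 (h2 this)
      exact mem_range.2 (by omega)

/-! ### The dual Jacobi–Trudi identity. -/

section JacobiTrudi

variable {N : ℕ} {c : Fin N → ℤ}

open Classical in
/-- The branching rule for Schur functions. -/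
theorem truncVars_succ_schurFunction (hc : IsColumnSeq c) (n : ℕ) :
    truncVars (n + 1) (schurFunction (columnDiagram c)) =
      ∑ s : Finset (Fin N), MvPowerSeries.X n ^ s.card *
        if IsColumnSeq (shortenColumns c s) then
          truncVars n (schurFunction (columnDiagram (shortenColumns c s))) else 0 := by
  ext d
  rw [coeff_truncVars, map_sum]
  have h : ∀ s : Finset (Fin N), MvPowerSeries.coeff d (MvPowerSeries.X n ^ s.card *
        if IsColumnSeq (shortenColumns c s) then
          truncVars n (schurFunction (columnDiagram (shortenColumns c s))) else 0) =
      if d.support ⊆ range (n + 1) then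
        (if IsColumnSeq (shortenColumns c s) ∧ d n = s.card then
          MvPowerSeries.coeff (d.erase n)
            (schurFunction (columnDiagram (shortenColumns c s))) else 0) else 0 := by
    intro s
    split_ifs with h1 h2 h3 h3 h3
    · rw [coeff_X_pow_mul_truncVars, if_pos ⟨h2, h3.2⟩]
    · rw [coeff_X_pow_mul_truncVars, if_neg fun h => h3 ⟨h1, h.2⟩]
    · rw [coeff_X_pow_mul_truncVars, if_neg fun h => h2 h.1]
    · exact absurd h3.1 h1
    · simp
    · simp
  rw [sum_congr rfl fun s _ => h s]
  split_ifs with hd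
  · change ((Nat.card _ : ℕ) : ℤ) = _
    rw [card_tableaux_eq_sum hc hd]
    push_cast
    rfl
  · simp

/-- These are the terms of the determinant recursion with no tableau counterpart. Either the last
column gets negative length and its row vanishes, or of two equal adjacent columns only the left is
shortened and their rows agree. -/
theorem columnDet_shortenColumns_eq_zero (hc : IsColumnSeq c) {s : Finset (Fin N)}
    (hs : ¬ IsColumnSeq (shortenColumns c s)) {R : Type*} [CommRing R] {e : ℤ → R}
    (he : ∀ k < 0, e k = 0) : columnDet e (shortenColumns c s) = 0 := by
  obtain _ | N := N
  · exact absurd ⟨fun i => i.elim0, fun i => i.elim0⟩ hs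
  by_cases hanti : Antitone (shortenColumns c s)
  · have hlast : shortenColumns c s (Fin.last N) < 0 := by
      by_contra h
      exact hs ⟨hanti, fun j => (not_lt.1 h).trans (hanti (Fin.le_last j))⟩
    exact columnDet_eq_zero_of_row_neg he _ (Fin.last N) (by
      rw [Fin.val_last]; push_cast; omega)
  · rw [Fin.antitone_iff_succ_le] at hanti
    push Not at hanti
    obtain ⟨i, hi⟩ := hanti
    refine columnDet_eq_zero_of_shifted_eq e _ (i := i.castSucc) (j := i.succ)
      (Fin.castSucc_lt_succ).ne ?_
    have h := hc.1 (Fin.castSucc_lt_succ (i := i)).le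
    unfold shortenColumns at hi ⊢
    rw [Fin.val_succ, Fin.val_castSucc]
    push_cast
    split_ifs at hi ⊢ <;> omega

theorem truncVars_zero_schurFunction (hc : IsColumnSeq c) :
    truncVars 0 (schurFunction (columnDiagram c)) = columnDet (elementarySeries 0) c := by
  by_cases h0 : ∀ j, c j = 0
  · have hE : columnDet (elementarySeries 0) c = 1 := by
      rw [columnDet, ← Matrix.det_one (n := Fin N)]
      congr 1
      ext1 i j
      simp only [Matrix.of_apply, elementarySeries, Matrix.one_apply, h0]
      refine if_congr ?_ rfl rfl
      rw [Fin.ext_iff]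
      omega
    have hempty : ∀ x, x ∉ columnDiagram c := by
      rintro ⟨i, j⟩ h
      obtain ⟨j, rfl⟩ : ∃ j' : Fin N, (j' : ℕ) = j := ⟨⟨j, lt_of_mem_columnDiagram h⟩, rfl⟩
      rw [mem_columnDiagram hc.1, h0] at h
      omega
    have hw : ∀ T : SemistandardYoungTableau (columnDiagram c), T.weight = 0 := fun T =>
      sum_eq_zero fun x hx => absurd ((YoungDiagram.mem_cells _).1 hx) (hempty x)
    rw [hE]
    ext d
    rw [coeff_truncVars, MvPowerSeries.coeff_one]
    by_cases hd : d = 0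
    · subst hd
      rw [if_pos (by simp), if_pos rfl]
      change ((Nat.card _ : ℕ) : ℤ) = 1
      rw [Nat.cast_eq_one, Nat.card_eq_one_iff_unique]
      refine ⟨⟨fun T T' => Subtype.ext (SemistandardYoungTableau.ext fun i j => ?_)⟩,
        ⟨⟨SemistandardYoungTableau.highestWeight _, hw _⟩⟩⟩
      rw [T.1.zeros (hempty _), T'.1.zeros (hempty _)]
    · rw [if_neg (by simpa using hd), if_neg hd]
  · push Not at h0
    obtain ⟨j, hj⟩ := h0
    have hN : 0 < N := j.pos
    have hpos : 0 < c ⟨0, hN⟩ :=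
      lt_of_lt_of_le (lt_of_le_of_ne (hc.2 j) hj.symm) (hc.1 (Fin.mk_le_of_le_val (Nat.zero_le _)))
    have hE : columnDet (elementarySeries 0) c = 0 :=
      Matrix.det_eq_zero_of_row_eq_zero ⟨0, hN⟩ fun k => if_neg (by simp; omega)
    rw [hE]
    ext d
    rw [coeff_truncVars, map_zero]
    by_cases hd : d = 0
    · subst hd
      rw [if_pos (by simp)]
      change ((Nat.card _ : ℕ) : ℤ) = 0
      rw [Nat.cast_eq_zero, Nat.card_eq_zero]
      left
      refine ⟨fun T => ?_⟩
      have h : (0, ((⟨0, hN⟩ : Fin N) : ℕ)) ∈ columnDiagram c :=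
        (mem_columnDiagram hc.1 _ _).2 hpos
      exact absurd (T.1.entry_lt_of_weight (n := 0) (by rw [T.2]; simp) h) (Nat.not_lt_zero _)
    · rw [if_neg (by simpa using hd)]

/-- The dual Jacobi–Trudi identity in finitely many variables. -/
theorem truncVars_schurFunction (n : ℕ) : ∀ {c : Fin N → ℤ}, IsColumnSeq c →
    truncVars n (schurFunction (columnDiagram c)) = columnDet (elementarySeries n) c := by
  induction n with
  | zero => exact truncVars_zero_schurFunction
  | succ n ih =>
    intro c hc
    rw [truncVars_succ_schurFunction hc]
    change _ = columnDet (fun k => elementarySeries n k +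
      MvPowerSeries.X n * elementarySeries n (k - 1)) c
    rw [columnDet_add_mul]
    refine sum_congr rfl fun s _ => ?_
    split_ifs with hs
    · rw [ih hs]
    · rw [columnDet_shortenColumns_eq_zero hc hs (elementarySeries_of_neg n)]

end JacobiTrudi

/-! ### Two-column Schur functions and the final identity. -/

theorem twoColumnDiagram_eq (i j : ℕ) :
    twoColumnDiagram i j = columnDiagram ![((i + j : ℕ) : ℤ), (i : ℤ)] := by
  have hc : Antitone ![((i + j : ℕ) : ℤ), (i : ℤ)] := by
    rw [Fin.antitone_iff_succ_le]
    intro k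
    fin_cases k
    simp
  ext ⟨x, y⟩
  rw [YoungDiagram.mem_cells, YoungDiagram.mem_cells, twoColumnDiagram,
    YoungDiagram.mem_ofRowLens]
  constructor
  · rintro ⟨h1, h2⟩
    simp only [List.length_append, List.length_replicate] at h1
    simp only [List.getElem_append, List.length_replicate, List.getElem_replicate] at h2
    have hy : y < 2 := by split_ifs at h2 <;> omega
    change (x, ((⟨y, hy⟩ : Fin 2) : ℕ)) ∈ _
    rw [mem_columnDiagram hc]
    interval_cases y
    · simp; omega
    · simp
      split_ifs at h2 <;> omega
  · intro h
    have hy := lt_of_mem_columnDiagram h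
    have h' := (mem_columnDiagram hc x ⟨y, hy⟩).1 h
    interval_cases y
    · simp only [Fin.zero_eta, Matrix.cons_val_zero, Nat.cast_lt] at h'
      refine ⟨by simpa using h', ?_⟩
      simp only [List.getElem_append, List.length_replicate, List.getElem_replicate]
      split_ifs <;> omega
    · simp only [Fin.mk_one, Matrix.cons_val_one, Matrix.cons_val_zero, Nat.cast_lt] at h'
      refine ⟨by simp; omega, ?_⟩
      simp only [List.getElem_append, List.length_replicate, List.getElem_replicate]
      split_ifs; omega

/-- For `i < 0` the zero convention agrees with the determinant, since both `e i` and `e (i - 1)`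
vanish. -/
theorem truncVars_schurTwoColumn (n : ℕ) (i j : ℤ) (hj : 0 ≤ j) :
    truncVars n (schurTwoColumn i j) = pairDet (elementarySeries n) (i + j) i := by
  have he := elementarySeries_of_neg n
  unfold schurTwoColumn
  split_ifs with h
  · have hij : (((i.toNat + j.toNat : ℕ) : ℤ)) = i + j := by omega
    have hi : ((i.toNat : ℕ) : ℤ) = i := by omega
    rw [twoColumnDiagram_eq, hij, hi, truncVars_schurFunction n, columnDet, Matrix.det_fin_two]
    · simp [pairDet]
    · constructor
      · rw [Fin.antitone_iff_succ_le]
        intro k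
        fin_cases k
        simpa using hj
      · intro k
        fin_cases k <;> simp <;> omega
  · rw [map_zero, pairDet, he i (by omega), he (i - 1) (by omega)]
    simp

theorem isColumnSeq_of_mem_interlacedPairs {u v : ℤ} {p : ℤ × ℤ} (hp : p ∈ interlacedPairs u v) :
    IsColumnSeq ![u - p.1, v - p.2, p.1, p.2] := by
  simp only [interlacedPairs, interlacedBox, mem_filter, mem_product, mem_Icc] at hp
  constructor
  · rw [Fin.antitone_iff_succ_le]
    intro k
    fin_cases k <;> simp <;> omega
  · intro k
    fin_cases k <;> simp <;> omega

theorem sum_schurD_eq (a b r : ℕ) (hab : a ≤ b) :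
    ∑ k ∈ range (r + 1), schurD (a : ℤ) (b : ℤ) (k : ℤ) (r : ℤ) =
      ∑ p ∈ interlacedPairs ((r : ℤ) - 1 - a) ((r : ℤ) - 1 - b),
        schurFunction (columnDiagram ![(r : ℤ) - 1 - a - p.1, (r : ℤ) - 1 - b - p.2, p.1, p.2]) := by
  refine eq_of_truncVars_eq fun n => ?_
  have he := elementarySeries_of_neg n
  rw [map_sum, map_sum, sum_congr rfl fun p hp =>
    truncVars_schurFunction n (isColumnSeq_of_mem_interlacedPairs hp)]
  -- The substitution `m = r - 1 - k` turns `0 ≤ k ≤ r` into `-1 ≤ m ≤ r - 1`.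
  have hS : Icc (-1) ((r : ℤ) - 1 - b) ⊆ (range (r + 1)).image fun k : ℕ => (r : ℤ) - 1 - k := by
    intro m hm
    rw [mem_Icc] at hm
    exact mem_image.2 ⟨((r : ℤ) - 1 - m).toNat, mem_range.2 (by omega), by omega⟩
  refine Eq.trans ?_ (sum_pairDet_mul he (by omega) hS)
  rw [sum_image fun x _ y _ h => by simpa using h]
  refine sum_congr rfl fun k _ => ?_
  rw [schurD, map_sub, map_add, map_mul, map_mul, map_mul,
    truncVars_schurTwoColumn n _ _ (by omega), truncVars_schurTwoColumn n _ _ le_rfl,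
    truncVars_schurTwoColumn n _ _ (by omega), truncVars_schurTwoColumn n _ _ (by omega),
    truncVars_schurTwoColumn n _ _ zero_le_one]
  ring_nf

theorem mainTheorem7 (a b r : ℕ) (hab : a ≤ b) :
    IsSchurPositive (∑ k ∈ Finset.range (r + 1), schurD (a : ℤ) (b : ℤ) (k : ℤ) (r : ℤ)) := by
  refine ⟨∑ p ∈ interlacedPairs ((r : ℤ) - 1 - a) ((r : ℤ) - 1 - b), Finsupp.single
    (columnDiagram ![(r : ℤ) - 1 - a - p.1, (r : ℤ) - 1 - b - p.2, p.1, p.2]) 1, fun μ => ?_, ?_⟩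
  · classical
    rw [Finsupp.finsetSum_apply]
    refine sum_nonneg fun p _ => ?_
    rw [Finsupp.single_apply]
    split_ifs <;> norm_num
  · refine (sum_schurD_eq a b r hab).trans (Eq.trans ?_ (Finsupp.sum_finsetSum_index
      (h := fun μ c => c • schurFunction μ) (fun _ => zero_smul _ _)
      fun _ _ _ => add_smul _ _ _))
    refine sum_congr rfl fun p _ => ?_
    exact ((Finsupp.sum_single_index (h := fun μ c => c • schurFunction μ)
      (zero_smul _ _)).trans (one_smul _ _)).symm
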